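/- Let $q\ge 2$ be an integer and let $\mathrm{BS}(1,q)=\langle a,b\mid aba^{-1}=b^q\rangle$. Let $T$ be the $(q+1)$-valent metric tree (edges of length one) whose vertices are the closed balls $B(P,q^{-r})$, $r\in\mathbb Z$, of the $q$-adic numbers $\mathbb{Q}_q$, where $B(P,q^{-r})$ is joined to $B(P,q^{-(r-1)})$, and let $\mathfrak h_T$ be the Busemann function on $T$ at the end $\omega$ towards which the radii increase; it takes the value $r$ at $B(P,q^{-r})$. Let $\mathbb H$ be the upper half-plane with the hyperbolic metric divided by $\log q$, so that the horocycles $\operatorname{Im} z=1$ and $\operatorname{Im} z=q^r$ are at distance $|r|$, and let $\mathfrak h_{\mathbb H}(z)=-\log_q \operatorname{Im} z$. Let $$X=\{(t,z)\in T\times\mathbb H : \mathfrak h_T(t)+\mathfrak h_{\mathbb H}(z)=0\}$$ be the treebolic space. It is the union of its sheets $\{(t,z)\in X : t\in\ell\}$, one for each geodesic line $\ell$ of $T$ with one end equal to $\omega$, and each sheet is identified with $\mathbb H$ by $(t,z)\mapsto z$. Let $d_X$ be the resulting intrinsic metric on $X$: $d_X(x,y)$ is the infimum of $\sum_i d_{\mathbb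 H}(z_i,z_{i+1})$ over all finite chains of points $(t_i,z_i)$ of $X$ from $x$ to $y$ in which any two consecutive points lie in a common sheet. The group $\mathrm{BS}(1,q)$ acts on $X$ through $a\mapsto\begin{pmatrix} q&0\\0&1\end{pmatrix}$, $b\mapsto\begin{pmatrix}1&1\\0&1\end{pmatrix}$, where $\begin{pmatrix} q^n&f\\0&1\end{pmatrix}$, with $n\in\mathbb Z$ and $f\in\mathbb Z[1/q]$, sends $B(P,q^{-r})$ to $B(f+q^nP,q^{-n-r})$ and $z$ to $q^nz+f$. Let $x=(B(0,1),i)$ and, for $\gamma\in\mathrm{BS}(1,q)$, let $|\gamma|=d_X(x,\gamma x)$. Then any two elements $u,v\in\mathrm{BS}(1,q)$ are conjugate in $\mathrm{BS}(1,q)$ if and only if there is $\gamma\in\mathrm{BS}(1,q)$ with $u\gamma=\gamma v$ and $$|\gamma|\le\frac{2}{\log\sqrt2}\,\bigl(|u|+|v|\bigr),$$ where $\log$ is the natural logarithm. -/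

import Mathlib

noncomputable section

namespace Treebolic

/-! ### The solvable Baumslag-Solitar group `⟨a, b ∣ a b a⁻¹ = b ^ q⟩` -/

/-- The two generators. -/
inductive Gen
  | a
  | b

/-- The single relator `a b a⁻¹ (b ^ q)⁻¹`. -/
def bsRels (q : ℕ) : Set (FreeGroup Gen) :=
  {FreeGroup.of Gen.a * FreeGroup.of Gen.b * (FreeGroup.of Gen.a)⁻¹ * (FreeGroup.of Gen.b ^ q)⁻¹}

/-- The Baumslag-Solitar group `BS(1, q)`, given by its presentation. -/
abbrev BS (q : ℕ) : Type := PresentedGroup (bsRels q)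

/-! ### The tree of `q`-adic balls -/

/-- The ring `ℤ[1/q]`, as a set of rational numbers. It is dense in the `q`-adic numbers. -/
def ZInv (q : ℕ) : Set ℚ := {f | ∃ (k : ℤ) (m : ℕ), f = k / (q : ℚ) ^ m}

lemma ZInv_int (q : ℕ) (k : ℤ) : (k : ℚ) ∈ ZInv q := ⟨k, 0, by simp⟩

lemma ZInv_zero (q : ℕ) : (0 : ℚ) ∈ ZInv q := ⟨0, 0, by simp⟩

lemma ZInv_one (q : ℕ) : (1 : ℚ) ∈ ZInv q := ⟨1, 0, by simp⟩

lemma ZInv_neg_one (q : ℕ) : (-1 : ℚ) ∈ ZInv q := ⟨-1, 0, by simp⟩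

lemma ZInv_add {q : ℕ} (hq : 2 ≤ q) {f g : ℚ} (hf : f ∈ ZInv q) (hg : g ∈ ZInv q) :
    f + g ∈ ZInv q := by
  have h0 : (q : ℚ) ≠ 0 := by exact_mod_cast (by omega : q ≠ 0)
  obtain ⟨k, m, rfl⟩ := hf
  obtain ⟨l, n, rfl⟩ := hg
  refine ⟨k * (q : ℤ) ^ n + l * (q : ℤ) ^ m, m + n, ?_⟩
  push_cast
  rw [pow_add]
  field_simp

lemma ZInv_zpow_mul {q : ℕ} (hq : 2 ≤ q) (n : ℤ) {f : ℚ} (hf : f ∈ ZInv q) :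
    (q : ℚ) ^ n * f ∈ ZInv q := by
  have h0 : (q : ℚ) ≠ 0 := by exact_mod_cast (by omega : q ≠ 0)
  obtain ⟨k, m, rfl⟩ := hf
  obtain ⟨j, rfl | rfl⟩ := n.eq_nat_or_neg
  · refine ⟨k * (q : ℤ) ^ j, m, ?_⟩
    push_cast
    rw [zpow_natCast]
    ring
  · refine ⟨k, m + j, ?_⟩
    rw [zpow_neg, zpow_natCast, pow_add]
    field_simp

/-- The closed ball `B(P, q ^ (-r))` for the `q`-adic distance, that is `P + q ^ r ℤ`. By density
of `ℤ[1/q]`, the balls of `ℤ[1/q]` correspond bijectively to the balls of the `q`-adic numbers. -/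
def qBall (q : ℕ) (P : ℚ) (r : ℤ) : Set ℚ := {g | ∃ k : ℤ, g = P + k * (q : ℚ) ^ r}

/-- The `(q + 1)`-valent metric tree (all edges of length one). Its vertices are the balls
`B(P, q ^ (-r))`, which have level `r ∈ ℤ`. The vertex `B(P, q ^ (-r))` is joined by an edge to its
parent `B(P, q ^ (1 - r))`, and hence to its `q` children, the balls of radius `q ^ (-r - 1)` that
it contains. A point of the open edge from a ball of level `r` to its parent is recorded by that
ball and by a real level in `(r - 1, r)`. The boundary point `ω` is the common end of all the
rays along which the level tends to `-∞`. -/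
@[ext]
structure Tree (q : ℕ) where
  /-- the level of the point: the value of the Busemann function at `ω` -/
  level : ℝ
  /-- the vertex at the end, away from `ω`, of the edge that holds the point -/
  ball : Set ℚ
  /-- the ball is a vertex of the right level -/
  isBall : ∃ P ∈ ZInv q, ball = qBall q P ⌈level⌉

/-- The bi-infinite geodesics `ℓ` of the tree that are asymptotic to `ω` at `-∞`, parametrised by
the level. The points `ℓ s` lie on one line as each one is an ancestor of the later ones. -/
def IsLine {q : ℕ} (ℓ : ℝ → Tree q) : Prop :=
  (∀ s, (ℓ s).level = s) ∧ ∀ s s', s ≤ s' → (ℓ s').ball ⊆ (ℓ s).ball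

/-! ### The hyperbolic plane, rescaled -/

/-- The metric of the upper half-plane, rescaled so that the horocycles `Im z = 1` and
`Im z = q ^ r` are at distance `r`. -/
def hypDist (q : ℕ) (z w : UpperHalfPlane) : ℝ := dist z w / Real.log q

/-- The Busemann function of the rescaled hyperbolic plane at `∞`, vanishing at `i`. -/
def busemannH (q : ℕ) (z : UpperHalfPlane) : ℝ := -Real.logb q z.im

/-! ### The treebolic space -/

/-- The treebolic space `X`: the horocyclic product of the tree and the hyperbolic plane. -/
def Space (q : ℕ) : Type := {p : Tree q × UpperHalfPlane // p.1.level + busemannH q p.2 = 0}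

/-- Two points of `X` lie in a common sheet: their tree components lie on a common geodesic line
asymptotic to `ω`. The sheet of such a line `ℓ`, the set of the points `(ℓ s, z)` of `X`, is a copy
of the hyperbolic plane by projection to `z`. -/
def InCommonSheet {q : ℕ} (x y : Space q) : Prop :=
  ∃ ℓ : ℝ → Tree q, IsLine ℓ ∧ (∃ s, ℓ s = x.1.1) ∧ ∃ s, ℓ s = y.1.1

/-- `L` is the length of a chain from `x` to `y` in `X`, each step of which takes place in one sheet
and is measured by the distance of that hyperbolic plane. -/
def IsChainLength {q : ℕ} (x y : Space q) (L : ℝ) : Prop :=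
  ∃ (n : ℕ) (c : ℕ → Space q), c 0 = x ∧ c n = y ∧ (∀ i < n, InCommonSheet (c i) (c (i + 1))) ∧
    L = ∑ i ∈ Finset.range n, hypDist q (c i).1.2 (c (i + 1)).1.2

/-- The intrinsic (length) metric of `X`, as the space glued from its sheets, each of which is a
hyperbolic plane with the rescaled metric: the infimum of the lengths of the chains. -/
def spaceDist {q : ℕ} (x y : Space q) : ℝ := sInf {L | IsChainLength x y L}

lemma logb_zpow_self {b : ℝ} (hb : 1 < b) (n : ℤ) : Real.logb b (b ^ n) = n := by
  rw [← Real.rpow_intCast, Real.logb_rpow (by linarith) hb.ne']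

lemma qBall_eq_of_mem {q : ℕ} {P Q : ℚ} {r : ℤ} (h : Q ∈ qBall q P r) :
    qBall q Q r = qBall q P r := by
  obtain ⟨k, rfl⟩ := h
  ext g
  constructor
  · rintro ⟨l, rfl⟩
    exact ⟨k + l, by push_cast; ring⟩
  · rintro ⟨l, rfl⟩
    exact ⟨l - k, by push_cast; ring⟩

lemma qBall_subset {q : ℕ} (hq : 2 ≤ q) (P : ℚ) {r s : ℤ} (h : r ≤ s) :
    qBall q P s ⊆ qBall q P r := by
  have h0 : (q : ℚ) ≠ 0 := by exact_mod_cast (by omega : q ≠ 0)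
  rintro _ ⟨k, rfl⟩
  obtain ⟨j, rfl⟩ := Int.le.dest h
  refine ⟨k * (q : ℤ) ^ j, ?_⟩
  push_cast
  rw [zpow_add₀ h0, zpow_natCast]
  ring

/-- Every `P ∈ ℤ[1/q]` gives a line, which at level `s` has the ball around `P`. -/
lemma exists_line {q : ℕ} (hq : 2 ≤ q) {P : ℚ} (hP : P ∈ ZInv q) :
    ∃ ℓ : ℝ → Tree q, IsLine ℓ ∧ ∀ s, (ℓ s).ball = qBall q P ⌈s⌉ :=
  ⟨fun s => ⟨s, qBall q P ⌈s⌉, P, hP, rfl⟩,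
    ⟨fun _ => rfl, fun _ _ h => qBall_subset hq P (Int.ceil_mono h)⟩, fun _ => rfl⟩

/-- Any two points of `X` are joined by a chain: the infimum in `spaceDist` is over a non-empty
set of non-negative numbers. -/
lemma exists_isChainLength {q : ℕ} (hq : 2 ≤ q) (x y : Space q) : ∃ L, IsChainLength x y L := by
  have h1 : (1 : ℝ) < q := by exact_mod_cast (by omega : 1 < q)
  have h0 : (0 : ℝ) < q := by linarith
  have h0' : (q : ℚ) ≠ 0 := by exact_mod_cast (by omega : q ≠ 0)
  have key : ∀ x : Space q, ∃ m : ℕ, ∀ w : Space q, ∀ n : ℕ, m ≤ n →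
      w.1.1.level = ((-(n : ℤ) : ℤ) : ℝ) → w.1.1.ball = qBall q 0 (-(n : ℤ)) →
      InCommonSheet x w := by
    intro x
    obtain ⟨P, hP, hb⟩ := x.1.1.isBall
    obtain ⟨k, m, hkm⟩ := id hP
    refine ⟨m, fun w n hn hl hw => ?_⟩
    obtain ⟨ℓ, hℓ, hball⟩ := exists_line hq hP
    refine ⟨ℓ, hℓ, ⟨x.1.1.level, Tree.ext (hℓ.1 _) ((hball _).trans hb.symm)⟩,
      ⟨w.1.1.level, Tree.ext (hℓ.1 _) ?_⟩⟩
    rw [hball, hl, Int.ceil_intCast, hw]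
    obtain ⟨j, rfl⟩ := Nat.exists_eq_add_of_le hn
    refine qBall_eq_of_mem ⟨k * (q : ℤ) ^ j, ?_⟩
    rw [hkm, zpow_neg, zpow_natCast, pow_add]
    push_cast
    field_simp
    ring
  obtain ⟨m, hm⟩ := key x
  obtain ⟨m', hm'⟩ := key y
  let N := max m m'
  let w : Space q :=
    ⟨(⟨((-(N : ℤ) : ℤ) : ℝ), qBall q 0 (-(N : ℤ)), 0, ZInv_zero q, by rw [Int.ceil_intCast]⟩,
      ⟨⟨0, (q : ℝ) ^ (-(N : ℤ))⟩, zpow_pos h0 _⟩), by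
      change ((-(N : ℤ) : ℤ) : ℝ) + -Real.logb q ((q : ℝ) ^ (-(N : ℤ))) = 0
      rw [logb_zpow_self h1, add_neg_cancel]⟩
  have hx := hm w N (le_max_left _ _) rfl rfl
  obtain ⟨ℓ, hℓ, hs, hs'⟩ := hm' w N (le_max_right _ _) rfl rfl
  refine ⟨_, 2, fun i => if i = 0 then x else if i = 1 then w else y, rfl, rfl, ?_, rfl⟩
  intro i hi
  obtain rfl | rfl : i = 0 ∨ i = 1 := by omega
  · exact hx
  · exact ⟨ℓ, hℓ, hs', hs⟩

/-! ### The action -/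

/-- The matrix `(q ^ n, f; 0, 1)`, with `n ∈ ℤ` and `f ∈ ℤ[1/q]`, sends the point of level `s` and
ball `B` of the tree to the point of level `s + n` and ball `f + q ^ n B`: on the vertices,
`B(P, q ^ (-r))` goes to `B(f + q ^ n P, q ^ (-n - r))`. -/
def actTree {q : ℕ} (hq : 2 ≤ q) (n : ℤ) (f : ℚ) (hf : f ∈ ZInv q) (t : Tree q) : Tree q where
  level := t.level + n
  ball := (fun g => f + (q : ℚ) ^ n * g) '' t.ball
  isBall := by
    have h0 : (q : ℚ) ≠ 0 := by exact_mod_cast (by omega : q ≠ 0)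
    obtain ⟨P, hP, hb⟩ := t.isBall
    refine ⟨f + (q : ℚ) ^ n * P, ZInv_add hq hf (ZInv_zpow_mul hq n hP), ?_⟩
    rw [hb, Int.ceil_add_intCast]
    ext g
    constructor
    · rintro ⟨_, ⟨k, rfl⟩, rfl⟩
      exact ⟨k, by simp only [zpow_add₀ h0]; ring⟩
    · rintro ⟨k, rfl⟩
      exact ⟨P + k * (q : ℚ) ^ ⌈t.level⌉, ⟨k, rfl⟩, by simp only [zpow_add₀ h0]; ring⟩

/-- The usual action of the matrix `(q ^ n, f; 0, 1)` on the upper half-plane, `z ↦ q ^ n z + f`. -/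
def actH {q : ℕ} (hq : 2 ≤ q) (n : ℤ) (f : ℚ) (z : UpperHalfPlane) : UpperHalfPlane :=
  ⟨(((q : ℝ) ^ n : ℝ) : ℂ) * z + ((f : ℝ) : ℂ), by
    have h0 : (0 : ℝ) < q := by exact_mod_cast (by omega : 0 < q)
    rw [Complex.add_im, Complex.ofReal_im, add_zero, Complex.im_ofReal_mul]
    exact mul_pos (zpow_pos h0 n) z.im_pos⟩

lemma actH_im {q : ℕ} (hq : 2 ≤ q) (n : ℤ) (f : ℚ) (z : UpperHalfPlane) :
    (actH hq n f z).im = (q : ℝ) ^ n * z.im := by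
  change ((((q : ℝ) ^ n : ℝ) : ℂ) * z + ((f : ℝ) : ℂ)).im = _
  rw [Complex.add_im, Complex.ofReal_im, add_zero, Complex.im_ofReal_mul, UpperHalfPlane.coe_im]

/-- The diagonal action of the matrix `(q ^ n, f; 0, 1)` on `X`. -/
def act {q : ℕ} (hq : 2 ≤ q) (n : ℤ) (f : ℚ) (hf : f ∈ ZInv q) (x : Space q) : Space q :=
  ⟨(actTree hq n f hf x.1.1, actH hq n f x.1.2), by
    have h1 : (1 : ℝ) < q := by exact_mod_cast (by omega : 1 < q)
    have h0 : (0 : ℝ) < q := by linarith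
    have hx : x.1.1.level + -Real.logb q x.1.2.im = 0 := x.2
    change x.1.1.level + n + -Real.logb q (actH hq n f x.1.2).im = 0
    rw [actH_im, Real.logb_mul (zpow_pos h0 n).ne' x.1.2.im_pos.ne', logb_zpow_self h1]
    linarith⟩

lemma space_ext {q : ℕ} {x y : Space q} (h1 : x.1.1.level = y.1.1.level)
    (h2 : x.1.1.ball = y.1.1.ball) (h3 : x.1.2 = y.1.2) : x = y :=
  Subtype.ext (Prod.ext (Tree.ext h1 h2) h3)

/-- The composition agrees with the product of matrices. -/
lemma act_act {q : ℕ} (hq : 2 ≤ q) {n m k : ℤ} {f g e : ℚ} (hf : f ∈ ZInv q) (hg : g ∈ ZInv q)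
    (he : e ∈ ZInv q) (hk : k = n + m) (h : e = f + (q : ℚ) ^ n * g) (x : Space q) :
    act hq n f hf (act hq m g hg x) = act hq k e he x := by
  have h0 : (q : ℚ) ≠ 0 := by exact_mod_cast (by omega : q ≠ 0)
  have h0' : (q : ℝ) ≠ 0 := by exact_mod_cast (by omega : q ≠ 0)
  subst hk h
  refine space_ext ?_ ?_ ?_
  · change x.1.1.level + m + n = x.1.1.level + ((n + m : ℤ) : ℝ)
    push_cast
    ring
  · change (fun g => f + (q : ℚ) ^ n * g) '' ((fun a => g + (q : ℚ) ^ m * a) '' x.1.1.ball) =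
      (fun a => f + (q : ℚ) ^ n * g + (q : ℚ) ^ (n + m) * a) '' x.1.1.ball
    rw [Set.image_image]
    refine congrArg (fun F => F '' x.1.1.ball) (funext fun a => ?_)
    rw [zpow_add₀ h0]
    ring
  · apply UpperHalfPlane.ext
    change (((q : ℝ) ^ n : ℝ) : ℂ) * ((((q : ℝ) ^ m : ℝ) : ℂ) * x.1.2 + ((g : ℝ) : ℂ)) +
      ((f : ℝ) : ℂ) = (((q : ℝ) ^ (n + m) : ℝ) : ℂ) * x.1.2 +
      (((f + (q : ℚ) ^ n * g : ℚ) : ℝ) : ℂ)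
    rw [zpow_add₀ h0']
    push_cast
    ring

lemma act_zero {q : ℕ} (hq : 2 ≤ q) (h : (0 : ℚ) ∈ ZInv q) (x : Space q) : act hq 0 0 h x = x := by
  refine space_ext ?_ ?_ ?_
  · change x.1.1.level + ((0 : ℤ) : ℝ) = _
    simp
  · change (fun a => (0 : ℚ) + (q : ℚ) ^ (0 : ℤ) * a) '' x.1.1.ball = _
    simp
  · apply UpperHalfPlane.ext
    change (((q : ℝ) ^ (0 : ℤ) : ℝ) : ℂ) * x.1.2 + (((0 : ℚ) : ℝ) : ℂ) = _
    simp

/-- The generator `a` acts through the matrix `(q, 0; 0, 1)` and `b` through `(1, 1; 0, 1)`. -/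
def genPerm {q : ℕ} (hq : 2 ≤ q) : Gen → Equiv.Perm (Space q)
  | Gen.a =>
    { toFun := act hq 1 0 (ZInv_zero q)
      invFun := act hq (-1) 0 (ZInv_zero q)
      left_inv := fun x => by
        rw [act_act hq _ _ (ZInv_zero q) (k := 0) (by simp) (by simp), act_zero]
      right_inv := fun x => by
        rw [act_act hq _ _ (ZInv_zero q) (k := 0) (by simp) (by simp), act_zero] }
  | Gen.b =>
    { toFun := act hq 0 1 (ZInv_one q)
      invFun := act hq 0 (-1) (ZInv_neg_one q)
      left_inv := fun x => by
        rw [act_act hq _ _ (ZInv_zero q) (k := 0) (by simp) (by simp), act_zero]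
      right_inv := fun x => by
        rw [act_act hq _ _ (ZInv_zero q) (k := 0) (by simp) (by simp), act_zero] }

lemma genPerm_b_pow {q : ℕ} (hq : 2 ≤ q) (k : ℕ) (x : Space q) :
    (genPerm hq Gen.b ^ k) x = act hq 0 k (ZInv_int q k) x := by
  induction k with
  | zero =>
    rw [pow_zero, Equiv.Perm.one_apply]
    have := act_zero hq (ZInv_zero q) x
    simpa using this.symm
  | succ k ih =>
    rw [pow_succ', Equiv.Perm.mul_apply, ih]
    exact act_act hq _ _ _ (by simp) (by push_cast; rw [zpow_zero]; ring) x

lemma genPerm_rels {q : ℕ} (hq : 2 ≤ q) (r : FreeGroup Gen) (hr : r ∈ bsRels q) :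
    FreeGroup.lift (genPerm hq) r = 1 := by
  rw [Set.mem_singleton_iff.mp hr]
  simp only [map_mul, map_inv, map_pow, FreeGroup.lift_apply_of]
  rw [mul_inv_eq_one, mul_inv_eq_iff_eq_mul]
  ext x
  rw [Equiv.Perm.mul_apply, Equiv.Perm.mul_apply, genPerm_b_pow]
  have hmem : (q : ℚ) ∈ ZInv q := ZInv_int q q
  have e1 := act_act hq (n := 1) (m := 0) (k := 1) (e := q) (ZInv_zero q) (ZInv_one q) hmem
    (by simp) (by simp) x
  have e2 := act_act hq (n := 0) (m := 1) (k := 1) (e := q) hmem (ZInv_zero q) hmem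
    (by simp) (by simp) x
  exact e1.trans e2.symm

/-- The action of `BS(1, q)` on `X`. -/
def bsAction {q : ℕ} (hq : 2 ≤ q) : BS q →* Equiv.Perm (Space q) :=
  PresentedGroup.toGroup (genPerm_rels hq)

/-- The basepoint `(B(0, 1), i)` of `X`. -/
def basepoint (q : ℕ) : Space q :=
  ⟨({ level := 0, ball := qBall q 0 0, isBall := ⟨0, ZInv_zero q, by simp⟩ }, UpperHalfPlane.I),
    by simp [busemannH]⟩

/-- The size `|γ|` of an element of `BS(1, q)`: the distance by which it moves the basepoint. -/
def size {q : ℕ} (hq : 2 ≤ q) (γ : BS q) : ℝ :=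
  spaceDist (basepoint q) (bsAction hq γ (basepoint q))

end Treebolic

/-!
The matrices `(q ^ n, f; 0, 1)` make `BS(1, q)` the group of affine maps `x ↦ q ^ n x + f` with
`f ∈ ℤ[1/q]`: every element acts on the treebolic space through a unique such matrix
(`exists_actsAs`, `ActsAs.unique`), and the normal form `a⁻ᵏ bᵐ aˡ` shows that the matrix determines
the element (`ActsAs.ext`). The size of an element controls its matrix, and conversely.

* Projecting a chain to the hyperbolic plane bounds `|n|` and `|f|` by the size
  (`hypDist_le_spaceDist`, `sq_le_zpow_mul_exp_dist`). Projecting it to the tree bounds the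
  denominator of `f`: a chain can leave a ball only through an ancestor of that ball, so it must climb
  to the level `M` of a ball that contains both `0` and `f`, which costs at least `n - 2 M`
  (`exists_mem_qBall_le_spaceDist`).
* Climbing to a ball of level `M` that contains `0` and `f`, then moving within the sheet of `f`,
  bounds the size from above by `-2 M` and a hyperbolic distance (`spaceDist_act_le`).

A conjugator `(k, h)` from `(n, f)` to `(n, g)` satisfies `q ^ k g = f + (q ^ n - 1) h`. If `n = 0`
and `f, g` are non-zero, then `(k, 0)` is a conjugator too, and a large `k` forces `f` to be large or
`g` to have a large denominator (`two_mul_le_of_eq_zpow_mul`); negative `k` is symmetric. If `n > 0`,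
multiplying the conjugator by a power of the second element brings `k` into `[0, n)`. Then `h` is at
most `q` times the larger of `|f|, |g|` (`sq_le_of_conj`), and it has no larger denominator since
`q ^ n - 1` is prime to `q` (`mem_qBall_of_mul_mem`). The additive errors are absorbed because the
sizes are at least `n ≥ 1` (`size_le_of_conj`). Negative `n` reduces to positive `n` by passing to
inverses (`MatrixBound.inv`). Altogether the constant `4` suffices, and `4 ≤ 2 / log √2`.
-/

namespace Treebolic

/-! ### Normal forms and affine coordinates in `BS(1, q)` -/

/-- The generator `a` of `BS(1, q)`. -/
def genA (q : ℕ) : BS q := PresentedGroup.of Gen.a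

/-- The generator `b` of `BS(1, q)`. -/
def genB (q : ℕ) : BS q := PresentedGroup.of Gen.b

lemma genA_conj_genB (q : ℕ) : genA q * genB q * (genA q)⁻¹ = genB q ^ q := by
  have h : PresentedGroup.mk (bsRels q) (FreeGroup.of Gen.a * FreeGroup.of Gen.b *
      (FreeGroup.of Gen.a)⁻¹ * (FreeGroup.of Gen.b ^ q)⁻¹) = 1 :=
    PresentedGroup.one_of_mem rfl
  simp only [map_mul, map_inv, map_pow] at h
  exact mul_inv_eq_one.mp h

lemma genA_mul_genB_zpow (q : ℕ) (m : ℤ) :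
    genA q * genB q ^ m = genB q ^ (q * m) * genA q := by
  rw [← mul_inv_eq_iff_eq_mul, ← conj_zpow, genA_conj_genB, zpow_mul, zpow_natCast]

lemma genA_pow_mul_genB_zpow (q : ℕ) (k : ℕ) (m : ℤ) :
    genA q ^ k * genB q ^ m = genB q ^ ((q : ℤ) ^ k * m) * genA q ^ k := by
  induction k with
  | zero => simp
  | succ k ih =>
    rw [pow_succ', mul_assoc, ih, ← mul_assoc, genA_mul_genB_zpow, pow_succ', mul_assoc, mul_assoc]

/-- Every element of `BS(1, q)` has the form `a⁻ᵏ bᵐ aˡ` with `k, l ≥ 0`. -/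
lemma exists_normal_form (q : ℕ) (γ : BS q) :
    ∃ (k l : ℕ) (m : ℤ), γ = (genA q ^ k)⁻¹ * genB q ^ m * genA q ^ l := by
  have hB : ∀ (j : ℤ) (k l : ℕ) (m : ℤ),
      genB q ^ j * ((genA q ^ k)⁻¹ * genB q ^ m * genA q ^ l) =
        (genA q ^ k)⁻¹ * genB q ^ ((q : ℤ) ^ k * j + m) * genA q ^ l := by
    intro j k l m
    have h : genB q ^ j * (genA q ^ k)⁻¹ = (genA q ^ k)⁻¹ * genB q ^ ((q : ℤ) ^ k * j) := by
      rw [mul_inv_eq_iff_eq_mul, mul_assoc, eq_inv_mul_iff_mul_eq, genA_pow_mul_genB_zpow]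
    rw [zpow_add, ← mul_assoc, ← mul_assoc, h]
    simp only [mul_assoc]
  have hγ : γ ∈ Subgroup.closure (Set.range (PresentedGroup.of (rels := bsRels q))) := by
    rw [PresentedGroup.closure_range_of]
    trivial
  induction hγ using Subgroup.closure_induction_left with
  | one => exact ⟨0, 0, 0, by simp⟩
  | mul_left x hx y _ ih =>
    obtain ⟨k, l, m, rfl⟩ := ih
    obtain ⟨g | g, rfl⟩ := hx
    · refine ⟨k, l + 1, q * m, ?_⟩
      change genA q * _ = _
      rw [← mul_assoc, ← mul_assoc, ← inv_pow, ((Commute.refl (genA q)).inv_right.pow_right k).eq,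
        inv_pow, pow_succ' _ l, mul_assoc _ (genA q), genA_mul_genB_zpow]
      simp only [mul_assoc]
    · exact ⟨k, l, (q : ℤ) ^ k * 1 + m, by rw [← hB, zpow_one]; rfl⟩
  | inv_mul_cancel x hx y _ ih =>
    obtain ⟨k, l, m, rfl⟩ := ih
    obtain ⟨g | g, rfl⟩ := hx
    · refine ⟨k + 1, l, m, ?_⟩
      change (genA q)⁻¹ * _ = _
      rw [pow_succ, mul_inv_rev]
      simp only [mul_assoc]
    · exact ⟨k, l, (q : ℤ) ^ k * (-1) + m, by rw [← hB, zpow_neg_one]; rfl⟩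

/-- `γ` acts on `X` through the matrix `(q ^ n, f; 0, 1)`. -/
def ActsAs {q : ℕ} (hq : 2 ≤ q) (γ : BS q) (n : ℤ) (f : ℚ) : Prop :=
  ∃ hf : f ∈ ZInv q, ∀ x, bsAction hq γ x = act hq n f hf x

lemma ActsAs.one {q : ℕ} (hq : 2 ≤ q) : ActsAs hq 1 0 0 :=
  ⟨ZInv_zero q, fun x => by rw [map_one, act_zero]; rfl⟩

lemma ActsAs.mul {q : ℕ} {hq : 2 ≤ q} {γ δ : BS q} {n m : ℤ} {f g : ℚ}
    (h : ActsAs hq γ n f) (h' : ActsAs hq δ m g) :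
    ActsAs hq (γ * δ) (n + m) (f + (q : ℚ) ^ n * g) := by
  obtain ⟨hf, h⟩ := h
  obtain ⟨hg, h'⟩ := h'
  refine ⟨ZInv_add hq hf (ZInv_zpow_mul hq n hg), fun x => ?_⟩
  rw [map_mul, Equiv.Perm.mul_apply, h', h, act_act hq hf hg _ rfl rfl]

lemma ActsAs.inv {q : ℕ} {hq : 2 ≤ q} {γ : BS q} {n : ℤ} {f : ℚ} (h : ActsAs hq γ n f) :
    ActsAs hq γ⁻¹ (-n) (-((q : ℚ) ^ (-n) * f)) := by
  have h0 : (q : ℚ) ≠ 0 := by exact_mod_cast (by omega : q ≠ 0)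
  obtain ⟨hf, h⟩ := h
  have hf' : -((q : ℚ) ^ (-n) * f) ∈ ZInv q := by
    obtain ⟨k, m, hkm⟩ := ZInv_zpow_mul hq (-n) hf
    exact ⟨-k, m, by rw [hkm]; push_cast; ring⟩
  refine ⟨hf', fun x => ?_⟩
  rw [map_inv, Equiv.Perm.inv_eq_iff_eq, h,
    act_act hq hf hf' (ZInv_zero q) (k := 0) (by ring) _, act_zero]
  rw [zpow_neg]
  field_simp
  ring

lemma ActsAs.exists_zpow {q : ℕ} {hq : 2 ≤ q} {γ : BS q} {n : ℤ} {f : ℚ} (h : ActsAs hq γ n f)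
    (i : ℤ) : ∃ x, ActsAs hq (γ ^ i) (i * n) x := by
  have hp : ∀ i : ℕ, ∃ x, ActsAs hq (γ ^ i) (i * n) x := by
    intro i
    induction i with
    | zero => exact ⟨0, by simpa using ActsAs.one hq⟩
    | succ i ih =>
      obtain ⟨x, hx⟩ := ih
      have := hx.mul h
      rw [← pow_succ, ← add_one_mul, ← Nat.cast_succ] at this
      exact ⟨_, this⟩
  obtain ⟨x, hx⟩ := hp i.natAbs
  obtain hi | hi := i.natAbs_eq
  · exact ⟨x, by rwa [← zpow_natCast, ← hi] at hx⟩
  · have := hx.inv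
    rw [← neg_mul, ← zpow_natCast, ← zpow_neg, ← hi] at this
    exact ⟨_, this⟩

/-- The coordinates are unique: they can be read off the image of the basepoint. -/
lemma ActsAs.unique {q : ℕ} {hq : 2 ≤ q} {γ : BS q} {n m : ℤ} {f g : ℚ}
    (h : ActsAs hq γ n f) (h' : ActsAs hq γ m g) : n = m ∧ f = g := by
  obtain ⟨hf, h⟩ := h
  obtain ⟨hg, h'⟩ := h'
  have e := (h (basepoint q)).symm.trans (h' (basepoint q))
  constructor
  · have e1 : (0 : ℝ) + (n : ℝ) = 0 + (m : ℝ) := congrArg (fun x : Space q => x.1.1.level) e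
    simpa using e1
  · have e1 : ((((q : ℝ) ^ n : ℝ) : ℂ) * Complex.I + ((f : ℝ) : ℂ)).re =
        ((((q : ℝ) ^ m : ℝ) : ℂ) * Complex.I + ((g : ℝ) : ℂ)).re :=
      congrArg (fun x : Space q => (x.1.2 : ℂ).re) e
    rw [Complex.add_re, Complex.add_re, Complex.re_ofReal_mul, Complex.re_ofReal_mul] at e1
    simpa using e1

lemma actsAs_genA_pow {q : ℕ} (hq : 2 ≤ q) (k : ℕ) : ActsAs hq (genA q ^ k) k 0 := by
  induction k with
  | zero => simpa using ActsAs.one hq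
  | succ k ih =>
    have h : ActsAs hq (genA q) 1 0 :=
      ⟨ZInv_zero q, fun x => by rw [genA, bsAction, PresentedGroup.toGroup.of]; rfl⟩
    simpa [pow_succ] using ih.mul h

lemma actsAs_genA_zpow {q : ℕ} (hq : 2 ≤ q) (k : ℤ) : ActsAs hq (genA q ^ k) k 0 := by
  obtain ⟨j, rfl | rfl⟩ := k.eq_nat_or_neg
  · simpa using actsAs_genA_pow hq j
  · simpa using (actsAs_genA_pow hq j).inv

lemma actsAs_genB_zpow {q : ℕ} (hq : 2 ≤ q) (m : ℤ) : ActsAs hq (genB q ^ m) 0 m := by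
  have hp : ∀ k : ℕ, ActsAs hq (genB q ^ k) 0 k := fun k =>
    ⟨ZInv_int q k, fun x => by
      rw [map_pow, genB, bsAction, PresentedGroup.toGroup.of, genPerm_b_pow]⟩
  obtain ⟨j, rfl | rfl⟩ := m.eq_nat_or_neg
  · simpa using hp j
  · simpa using (hp j).inv

lemma actsAs_normal_form {q : ℕ} (hq : 2 ≤ q) (k l : ℕ) (m : ℤ) :
    ActsAs hq ((genA q ^ k)⁻¹ * genB q ^ m * genA q ^ l) (-k + l) ((q : ℚ) ^ (-(k : ℤ)) * m) := by
  simpa using ((actsAs_genA_pow hq k).inv.mul (actsAs_genB_zpow hq m)).mul (actsAs_genA_pow hq l)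

lemma exists_actsAs {q : ℕ} (hq : 2 ≤ q) (γ : BS q) : ∃ n f, ActsAs hq γ n f := by
  obtain ⟨k, l, m, rfl⟩ := exists_normal_form q γ
  exact ⟨_, _, actsAs_normal_form hq k l m⟩

/-- The action is faithful: an element is determined by its matrix. -/
lemma ActsAs.ext {q : ℕ} {hq : 2 ≤ q} {γ δ : BS q} {n : ℤ} {f : ℚ}
    (h : ActsAs hq γ n f) (h' : ActsAs hq δ n f) : γ = δ := by
  have h0 : (q : ℚ) ≠ 0 := by exact_mod_cast (by omega : q ≠ 0)
  have h1 := h.mul h'.inv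
  rw [← mul_inv_eq_one]
  obtain ⟨k, l, m, e⟩ := exists_normal_form q (γ * δ⁻¹)
  rw [e] at h1 ⊢
  obtain ⟨e1, e2⟩ := (actsAs_normal_form hq k l m).unique h1
  obtain rfl : k = l := by omega
  have e3 : (q : ℚ) ^ (-(k : ℤ)) * m = 0 := by
    rw [e2, zpow_neg]
    field_simp
    ring
  have e4 : m = 0 := by
    have := (mul_eq_zero.mp e3).resolve_left (zpow_ne_zero _ h0)
    exact_mod_cast this
  rw [e4]
  simp

/-! ### Lower bounds for the metric -/

lemma hypDist_le_spaceDist {q : ℕ} (hq : 2 ≤ q) (x y : Space q) :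
    hypDist q x.1.2 y.1.2 ≤ spaceDist x y := by
  have hlog : 0 < Real.log q := Real.log_pos (by exact_mod_cast hq)
  refine le_csInf (exists_isChainLength hq x y) ?_
  rintro _ ⟨n, c, rfl, rfl, -, rfl⟩
  simp only [hypDist, ← Finset.sum_div]
  gcongr
  exact dist_le_range_sum_dist (fun i => (c i).1.2) n

/-- The level is a Lipschitz function of the hyperbolic component. -/
lemma abs_level_sub_le {q : ℕ} (hq : 2 ≤ q) (x y : Space q) :
    |x.1.1.level - y.1.1.level| ≤ hypDist q x.1.2 y.1.2 := by
  have hlog : 0 < Real.log q := Real.log_pos (by exact_mod_cast hq)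
  have h : ∀ x : Space q, x.1.1.level = Real.log x.1.2.im / Real.log q := fun x => by
    have := x.2
    rw [busemannH, Real.logb] at this
    linarith
  rw [h x, h y, ← sub_div, abs_div, abs_of_pos hlog, hypDist]
  gcongr
  exact UpperHalfPlane.dist_log_im_le _ _

/-- A chain has to climb towards `ω` at least to the level of a ball that contains the balls of
both its ends. -/
lemma IsChainLength.exists_common_ball {q : ℕ} (hq : 2 ≤ q) {x y : Space q} {L : ℝ}
    (h : IsChainLength x y L) : ∃ (m : ℝ) (P : ℚ), m ≤ x.1.1.level ∧ m ≤ y.1.1.level ∧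
      (x.1.1.level - m) + (y.1.1.level - m) ≤ L ∧
      x.1.1.ball ⊆ qBall q P ⌈m⌉ ∧ y.1.1.ball ⊆ qBall q P ⌈m⌉ := by
  obtain ⟨n, c, rfl, rfl, hc, rfl⟩ := h
  induction n with
  | zero =>
    obtain ⟨P, -, hb⟩ := (c 0).1.1.isBall
    exact ⟨_, P, le_rfl, le_rfl, by simp, hb.subset, hb.subset⟩
  | succ n ih =>
    obtain ⟨m, P, h0, h1, hL, hs0, hs1⟩ := ih fun i hi => hc i (by omega)
    rw [Finset.sum_range_succ]
    have hd := abs_le.mp (abs_level_sub_le hq (c n) (c (n + 1)))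
    have hmono : qBall q P ⌈m⌉ ⊆ qBall q P ⌈min m (c (n + 1)).1.1.level⌉ :=
      qBall_subset hq P (Int.ceil_mono (min_le_left _ _))
    refine ⟨min m (c (n + 1)).1.1.level, P, (min_le_left _ _).trans h0, min_le_right _ _, ?_,
      hs0.trans hmono, ?_⟩
    · rcases min_cases m (c (n + 1)).1.1.level with ⟨e, h⟩ | ⟨e, h⟩ <;> rw [e] <;> linarith
    · obtain ⟨ℓ, ⟨hl1, hl2⟩, ⟨s, hs⟩, s', hs'⟩ := hc n (by omega)
      rcases le_total s s' with hle | hle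
      · have := hl2 _ _ hle
        rw [hs, hs'] at this
        exact (this.trans hs1).trans hmono
      · have hsub := hl2 _ _ hle
        rw [hs, hs'] at hsub
        obtain ⟨Q, -, hQ⟩ := (c (n + 1)).1.1.isBall
        obtain ⟨R, -, hR⟩ := (c n).1.1.isBall
        have hQ' : (c (n + 1)).1.1.ball ⊆ qBall q Q ⌈min m (c (n + 1)).1.1.level⌉ := by
          rw [hQ]
          exact qBall_subset hq Q (Int.ceil_mono (min_le_right _ _))
        -- balls of the same level that share the point `R` coincide
        have hRm : R ∈ (c n).1.1.ball := by rw [hR]; exact ⟨0, by simp⟩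
        rwa [← qBall_eq_of_mem (hQ' (hsub hRm)), qBall_eq_of_mem (hmono (hs1 hRm))] at hQ'

/-- The contribution of the tree to the metric: the ends of the chain lie in a common ball of level
`M`, and the distance is at least the length of the path through that ball. -/
lemma exists_mem_qBall_le_spaceDist {q : ℕ} (hq : 2 ≤ q) (n : ℤ) {f : ℚ} (hf : f ∈ ZInv q) :
    ∃ M : ℤ, M ≤ 0 ∧ M ≤ n ∧ f ∈ qBall q 0 M ∧
      ((n - 2 * M : ℤ) : ℝ) ≤ spaceDist (basepoint q) (act hq n f hf (basepoint q)) := by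
  set y := act hq n f hf (basepoint q) with hy
  -- the left-hand side is an integer, so a chain that is almost shortest suffices
  obtain ⟨L, hL, hlt⟩ := exists_lt_of_csInf_lt (exists_isChainLength hq (basepoint q) y)
    (Int.lt_floor_add_one (spaceDist (basepoint q) y))
  obtain ⟨m, P, h0, h1, hmL, hs0, hs1⟩ := IsChainLength.exists_common_ball hq hL
  have e0 : (basepoint q).1.1.level = 0 := rfl
  have e1 : y.1.1.level = 0 + (n : ℝ) := rfl
  rw [e0] at h0 hmL
  rw [e1, zero_add] at h1 hmL
  have hm : m ≤ ⌈m⌉ := Int.le_ceil m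
  have hmem0 : (0 : ℚ) ∈ qBall q P ⌈m⌉ := hs0 ⟨0, by simp⟩
  have hmemf : f ∈ qBall q P ⌈m⌉ := hs1 ⟨0, ⟨0, by simp⟩, by simp⟩
  refine ⟨⌈m⌉, Int.ceil_le.mpr (by simpa using h0), Int.ceil_le.mpr h1, ?_, ?_⟩
  · rwa [qBall_eq_of_mem hmem0]
  · have h2 : ((n - 2 * ⌈m⌉ : ℤ) : ℝ) < ((⌊spaceDist (basepoint q) y⌋ + 1 : ℤ) : ℝ) := by
      push_cast
      linarith
    have h3 : n - 2 * ⌈m⌉ ≤ ⌊spaceDist (basepoint q) y⌋ :=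
      Int.lt_add_one_iff.mp (by exact_mod_cast h2)
    exact Int.le_floor.mp h3

/-! ### An upper bound for the metric -/

lemma spaceDist_le_of_inCommonSheet {q : ℕ} (hq : 2 ≤ q) {x y w : Space q}
    (h : InCommonSheet x w) (h' : InCommonSheet w y) :
    spaceDist x y ≤ hypDist q x.1.2 w.1.2 + hypDist q w.1.2 y.1.2 := by
  have hlog : 0 < Real.log q := Real.log_pos (by exact_mod_cast hq)
  refine csInf_le ⟨0, ?_⟩ ⟨2, fun i => if i = 0 then x else if i = 1 then w else y, rfl, rfl, ?_, ?_⟩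
  · rintro _ ⟨n, c, -, -, -, rfl⟩
    exact Finset.sum_nonneg fun i _ => div_nonneg dist_nonneg hlog.le
  · intro i hi
    obtain rfl | rfl : i = 0 ∨ i = 1 := by omega
    · exact h
    · exact h'
  · simp [Finset.sum_range_succ]

/-- Going up to the ball of level `M` that contains both `0` and `h`, and then within the sheet of
`h`, gives an upper bound for the displacement of the basepoint. -/
lemma spaceDist_act_le {q : ℕ} (hq : 2 ≤ q) (k : ℤ) {h : ℚ} (hh : h ∈ ZInv q) {M : ℤ} (hM : M ≤ 0)
    (hmem : h ∈ qBall q 0 M) :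
    spaceDist (basepoint q) (act hq k h hh (basepoint q)) ≤
      -2 * (M : ℝ) + hypDist q UpperHalfPlane.I (actH hq k h UpperHalfPlane.I) := by
  have h1 : (1 : ℝ) < q := by exact_mod_cast (by omega : 1 < q)
  have h0 : (0 : ℝ) < q := by linarith
  have h0' : (q : ℚ) ≠ 0 := by exact_mod_cast (by omega : q ≠ 0)
  have hlog : 0 < Real.log q := Real.log_pos h1
  let w : Space q :=
    ⟨(⟨(M : ℝ), qBall q 0 M, 0, ZInv_zero q, by rw [Int.ceil_intCast]⟩,
      ⟨⟨0, (q : ℝ) ^ M⟩, zpow_pos h0 _⟩), by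
      change (M : ℝ) + -Real.logb q ((q : ℝ) ^ M) = 0
      rw [logb_zpow_self h1, add_neg_cancel]⟩
  have hxw : InCommonSheet (basepoint q) w := by
    obtain ⟨ℓ, hℓ, hb⟩ := exists_line hq (ZInv_zero q)
    refine ⟨ℓ, hℓ, ⟨0, Tree.ext (hℓ.1 _) ?_⟩, ⟨(M : ℝ), Tree.ext (hℓ.1 _) ?_⟩⟩
    · rw [hb, Int.ceil_zero]; rfl
    · rw [hb, Int.ceil_intCast]
  have hwy : InCommonSheet w (act hq k h hh (basepoint q)) := by
    obtain ⟨ℓ, hℓ, hb⟩ := exists_line hq hh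
    refine ⟨ℓ, hℓ, ⟨(M : ℝ), Tree.ext (hℓ.1 _) ?_⟩, ⟨0 + (k : ℝ), Tree.ext (hℓ.1 _) ?_⟩⟩
    · rw [hb, Int.ceil_intCast, qBall_eq_of_mem hmem]
    · rw [hb, zero_add, Int.ceil_intCast]
      change _ = (fun g => h + (q : ℚ) ^ k * g) '' qBall q 0 0
      ext g
      constructor
      · rintro ⟨j, rfl⟩
        exact ⟨j, ⟨j, by simp⟩, by ring⟩
      · rintro ⟨_, ⟨j, rfl⟩, rfl⟩
        exact ⟨j, by simp; ring⟩
  have hIw : dist UpperHalfPlane.I w.1.2 = -M * Real.log q := by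
    rw [UpperHalfPlane.dist_of_re_eq (by rfl)]
    change dist (Real.log 1) (Real.log ((q : ℝ) ^ M)) = _
    rw [Real.log_one, Real.log_zpow, Real.dist_eq, zero_sub, ← neg_mul, abs_of_nonneg]
    exact mul_nonneg (by exact_mod_cast neg_nonneg.mpr hM) hlog.le
  refine (spaceDist_le_of_inCommonSheet hq hxw hwy).trans ?_
  change dist UpperHalfPlane.I w.1.2 / _ + dist w.1.2 (actH hq k h UpperHalfPlane.I) / _ ≤
    _ + dist UpperHalfPlane.I (actH hq k h UpperHalfPlane.I) / _
  have ht := dist_triangle w.1.2 UpperHalfPlane.I (actH hq k h UpperHalfPlane.I)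
  rw [dist_comm w.1.2 UpperHalfPlane.I, hIw] at ht
  rw [hIw, ← add_div, div_le_iff₀ hlog, add_mul, div_mul_cancel₀ _ hlog.ne']
  linarith

/-! ### Hyperbolic estimates -/

lemma two_mul_cosh_dist_actH {q : ℕ} (hq : 2 ≤ q) (n : ℤ) (f : ℚ) :
    2 * Real.cosh (dist UpperHalfPlane.I (actH hq n f UpperHalfPlane.I)) =
      (q : ℝ) ^ n + ((q : ℝ) ^ n)⁻¹ + (f : ℝ) ^ 2 / (q : ℝ) ^ n := by
  have h0 : (0 : ℝ) < q := by exact_mod_cast (by omega : 0 < q)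
  have hp : 0 < (q : ℝ) ^ n := zpow_pos h0 n
  rw [UpperHalfPlane.cosh_dist, actH_im, UpperHalfPlane.I_im, Complex.dist_eq,
    ← Complex.normSq_eq_norm_sq]
  change 2 * (1 + Complex.normSq (Complex.I - ((((q : ℝ) ^ n : ℝ) : ℂ) * Complex.I +
    ((f : ℝ) : ℂ))) / _) = _
  rw [Complex.normSq_apply]
  simp only [Complex.sub_re, Complex.sub_im, Complex.add_re, Complex.add_im, Complex.re_ofReal_mul,
    Complex.im_ofReal_mul, Complex.I_re, Complex.I_im, Complex.ofReal_re, Complex.ofReal_im]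
  field_simp
  ring

lemma sq_le_zpow_mul_exp_dist {q : ℕ} (hq : 2 ≤ q) (n : ℤ) (f : ℚ) :
    (f : ℝ) ^ 2 ≤
      (q : ℝ) ^ n * Real.exp (dist UpperHalfPlane.I (actH hq n f UpperHalfPlane.I)) := by
  have h0 : (0 : ℝ) < q := by exact_mod_cast (by omega : 0 < q)
  have hp : 0 < (q : ℝ) ^ n := zpow_pos h0 n
  have h := two_mul_cosh_dist_actH hq n f
  set d := dist UpperHalfPlane.I (actH hq n f UpperHalfPlane.I)
  have hd : Real.exp (-d) ≤ 1 := Real.exp_le_one_iff.mpr (neg_nonpos.mpr dist_nonneg)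
  rw [Real.cosh_eq] at h
  have h2 : 2 ≤ (q : ℝ) ^ n + ((q : ℝ) ^ n)⁻¹ := by
    have : (q : ℝ) ^ n * ((q : ℝ) ^ n)⁻¹ = 1 := mul_inv_cancel₀ hp.ne'
    nlinarith [sq_nonneg ((q : ℝ) ^ n - ((q : ℝ) ^ n)⁻¹), inv_pos.mpr hp]
  rw [mul_comm, ← div_le_iff₀ hp]
  linarith

lemma exp_dist_le {q : ℕ} (hq : 2 ≤ q) {k : ℤ} (hk : 0 ≤ k) (h : ℚ) :
    Real.exp (dist UpperHalfPlane.I (actH hq k h UpperHalfPlane.I)) ≤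
      (q : ℝ) ^ k + 1 + (h : ℝ) ^ 2 := by
  have hp : 1 ≤ (q : ℝ) ^ k := one_le_zpow₀ (by exact_mod_cast (by omega : 1 ≤ q)) hk
  have e := two_mul_cosh_dist_actH hq k h
  rw [Real.cosh_eq] at e
  have h1 : ((q : ℝ) ^ k)⁻¹ ≤ 1 := inv_le_one_of_one_le₀ hp
  have h2 : (h : ℝ) ^ 2 / (q : ℝ) ^ k ≤ (h : ℝ) ^ 2 := div_le_self (sq_nonneg _) hp
  have h3 := Real.exp_pos (-dist UpperHalfPlane.I (actH hq k h UpperHalfPlane.I))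
  linarith

lemma hypDist_actH_zero {q : ℕ} (hq : 2 ≤ q) (k : ℤ) :
    hypDist q UpperHalfPlane.I (actH hq k 0 UpperHalfPlane.I) = |(k : ℝ)| := by
  have hlog : 0 < Real.log q := Real.log_pos (by exact_mod_cast hq)
  have hre : UpperHalfPlane.I.re = (actH hq k 0 UpperHalfPlane.I).re := by
    change (0 : ℝ) = ((((q : ℝ) ^ k : ℝ) : ℂ) * Complex.I + (((0 : ℚ) : ℝ) : ℂ)).re
    rw [Complex.add_re, Complex.re_ofReal_mul]
    simp
  rw [hypDist, UpperHalfPlane.dist_of_re_eq hre, actH_im, UpperHalfPlane.I_im, Real.log_one, mul_one,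
    Real.log_zpow, Real.dist_eq, zero_sub, abs_neg, abs_mul, abs_of_pos hlog,
    mul_div_cancel_right₀ _ hlog.ne']

/-! ### Sizes and coordinates -/

/-- What a bound `L` on the size of an element says about its matrix `(q ^ n, f; 0, 1)`. The last
field combines the size of the denominator of `f` with the exponent `n`. -/
structure MatrixBound (q : ℕ) (n : ℤ) (f : ℚ) (L : ℝ) : Prop where
  abs_le : |(n : ℝ)| ≤ L
  sq_le : (f : ℝ) ^ 2 ≤ (q : ℝ) ^ n * Real.exp (Real.log q * L)
  exists_mem : ∃ M : ℤ, M ≤ 0 ∧ M ≤ n ∧ f ∈ qBall q 0 M ∧ (n : ℝ) - 2 * M ≤ L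

lemma ActsAs.size_eq {q : ℕ} {hq : 2 ≤ q} {γ : BS q} {n : ℤ} {f : ℚ} (h : ActsAs hq γ n f) :
    ∃ hf : f ∈ ZInv q, size hq γ = spaceDist (basepoint q) (act hq n f hf (basepoint q)) := by
  obtain ⟨hf, h⟩ := h
  exact ⟨hf, by rw [size, h]⟩

lemma ActsAs.matrixBound {q : ℕ} {hq : 2 ≤ q} {γ : BS q} {n : ℤ} {f : ℚ} (h : ActsAs hq γ n f) :
    MatrixBound q n f (size hq γ) := by
  obtain ⟨hf, h⟩ := h.size_eq
  rw [h]
  have hlog : 0 < Real.log q := Real.log_pos (by exact_mod_cast hq)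
  have h0 : (0 : ℝ) < q := by exact_mod_cast (by omega : 0 < q)
  have hd := hypDist_le_spaceDist hq (basepoint q) (act hq n f hf (basepoint q))
  refine ⟨?_, ?_, ?_⟩
  · have hl := (abs_level_sub_le hq (basepoint q) (act hq n f hf (basepoint q))).trans hd
    change |(0 : ℝ) - (0 + (n : ℝ))| ≤ _ at hl
    simpa using hl
  · refine (sq_le_zpow_mul_exp_dist hq n f).trans ?_
    refine mul_le_mul_of_nonneg_left (Real.exp_le_exp.mpr ?_) (zpow_pos h0 n).le
    rw [hypDist, div_le_iff₀' hlog] at hd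
    exact hd
  · obtain ⟨M, h1, h2, h3, h4⟩ := exists_mem_qBall_le_spaceDist hq n hf
    exact ⟨M, h1, h2, h3, by exact_mod_cast h4⟩

/-- The bounds pass to the inverse matrix: `M` is replaced by `M - n`. -/
lemma MatrixBound.inv {q : ℕ} (hq : 2 ≤ q) {n : ℤ} {f : ℚ} {L : ℝ} (h : MatrixBound q n f L) :
    MatrixBound q (-n) (-((q : ℚ) ^ (-n) * f)) L := by
  have h0 : (q : ℚ) ≠ 0 := by exact_mod_cast (by omega : q ≠ 0)
  have h0' : (0 : ℝ) < q := by exact_mod_cast (by omega : 0 < q)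
  obtain ⟨h1, h2, M, hM, hMn, ⟨j, hj⟩, hML⟩ := h
  refine ⟨by simpa using h1, ?_, M - n, by omega, by omega, ⟨-j, ?_⟩, ?_⟩
  · have hp : 0 < (q : ℝ) ^ (-n) := zpow_pos h0' _
    have e : (q : ℝ) ^ (-n) * (q : ℝ) ^ n = 1 := by
      rw [← zpow_add₀ h0'.ne', neg_add_cancel, zpow_zero]
    push_cast
    calc (-((q : ℝ) ^ (-n) * f)) ^ 2 = (q : ℝ) ^ (-n) * (q : ℝ) ^ (-n) * (f : ℝ) ^ 2 := by ring
      _ ≤ (q : ℝ) ^ (-n) * (q : ℝ) ^ (-n) * ((q : ℝ) ^ n * Real.exp (Real.log q * L)) := by gcongr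
      _ = (q : ℝ) ^ (-n) * ((q : ℝ) ^ (-n) * (q : ℝ) ^ n) * Real.exp (Real.log q * L) := by ring
      _ = _ := by rw [e, mul_one]
  · rw [hj, sub_eq_add_neg, zpow_add₀ h0]
    push_cast
    ring
  · push_cast
    linarith

lemma zpow_eq_exp {q : ℕ} (hq : 2 ≤ q) (n : ℤ) : (q : ℝ) ^ n = Real.exp (Real.log q * n) := by
  have h0 : (0 : ℝ) < q := by exact_mod_cast (by omega : 0 < q)
  rw [← Real.rpow_intCast, Real.rpow_def_of_pos h0]

/-! ### Conjugators of elements of level zero -/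

/-- If `f = q ^ k g` is non-zero, then either `f` is large or `g` has a large denominator. -/
lemma two_mul_le_of_eq_zpow_mul {q : ℕ} (hq : 2 ≤ q) {f g : ℚ} {L L' : ℝ} {k : ℤ} (hg : g ≠ 0)
    (e : f = (q : ℚ) ^ k * g) (hf : MatrixBound q 0 f L) (h : MatrixBound q 0 g L') :
    2 * (k : ℝ) ≤ L + L' := by
  have h0 : (q : ℚ) ≠ 0 := by exact_mod_cast (by omega : q ≠ 0)
  have h0' : (0 : ℝ) < q := by exact_mod_cast (by omega : 0 < q)
  have hlog : 0 < Real.log q := Real.log_pos (by exact_mod_cast hq)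
  obtain ⟨M, -, -, ⟨j, hj⟩, hM⟩ := h.exists_mem
  rw [zero_add] at hj
  have hj0 : j ≠ 0 := by
    rintro rfl
    simp [hj] at hg
  have hj1 : (1 : ℝ) ≤ (j : ℝ) ^ 2 := by
    have : 1 ≤ j ^ 2 := by have := sq_pos_of_ne_zero hj0; omega
    exact_mod_cast this
  have hfs : (f : ℝ) ^ 2 = (j : ℝ) ^ 2 * Real.exp (Real.log q * (2 * (k + M))) := by
    rw [e, hj]
    push_cast
    rw [zpow_eq_exp hq, zpow_eq_exp hq, mul_left_comm, mul_pow, ← Real.exp_add, ← Real.exp_nat_mul]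
    push_cast
    ring_nf
  have h1 : Real.exp (Real.log q * (2 * (k + M))) ≤ Real.exp (Real.log q * L) := by
    have h2 := hf.sq_le
    rw [zpow_zero, one_mul, hfs] at h2
    exact (le_mul_of_one_le_left (Real.exp_pos _).le hj1).trans h2
  have h3 := le_of_mul_le_mul_left (Real.exp_le_exp.mp h1) hlog
  push_cast at hM
  linarith

/-! ### Conjugators of elements of non-zero level -/

/-- As `q ^ n - 1` is prime to `q`, dividing by it does not create new denominators. -/
lemma mem_qBall_of_mul_mem {q : ℕ} (hq : 2 ≤ q) {n : ℕ} (hn : 0 < n) {h : ℚ} (hh : h ∈ ZInv q)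
    {M : ℤ} (hM : h * ((q : ℚ) ^ n - 1) ∈ qBall q 0 M) : h ∈ qBall q 0 M := by
  have h0 : (q : ℚ) ≠ 0 := by exact_mod_cast (by omega : q ≠ 0)
  obtain ⟨j, hj⟩ := hM
  obtain ⟨l, m, hlm⟩ := ZInv_zpow_mul hq (-M) hh
  have hp : (q : ℚ) ^ (-M) * (q : ℚ) ^ M = 1 := by
    rw [← zpow_add₀ h0, neg_add_cancel, zpow_zero]
  have e : l * ((q : ℤ) ^ n - 1) = j * (q : ℤ) ^ m := by
    have : (l : ℚ) * ((q : ℚ) ^ n - 1) = j * (q : ℚ) ^ m := by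
      rw [eq_div_iff (pow_ne_zero _ h0)] at hlm
      rw [zero_add] at hj
      rw [← hlm]
      linear_combination (q : ℚ) ^ (-M) * (q : ℚ) ^ m * hj + (q : ℚ) ^ m * j * hp
    exact_mod_cast this
  have hcop : IsCoprime ((q : ℤ) ^ m) ((q : ℤ) ^ n - 1) := by
    refine IsCoprime.pow_left ⟨(q : ℤ) ^ (n - 1), -1, ?_⟩
    rw [← pow_succ, Nat.sub_add_cancel hn]
    ring
  obtain ⟨i, hi⟩ := hcop.dvd_of_dvd_mul_right (Dvd.intro_left j e.symm)
  refine ⟨i, ?_⟩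
  have hi' : (q : ℚ) ^ (-M) * h = i := by
    rw [hlm, hi]
    push_cast
    field_simp
  rw [zero_add, ← hi', mul_right_comm, hp, one_mul]

/-- The translation part of a conjugator whose exponent `k` is a residue mod `n`. -/
lemma sq_le_of_conj {q : ℕ} (hq : 2 ≤ q) {n k : ℕ} (hkn : k < n) {f g h : ℚ} {B : ℝ}
    (e : h * ((q : ℚ) ^ n - 1) = (q : ℚ) ^ k * g - f) (hf : (f : ℝ) ^ 2 ≤ B)
    (hg : (g : ℝ) ^ 2 ≤ B) : (h : ℝ) ^ 2 ≤ (q : ℝ) ^ 2 * B := by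
  have h2 : (2 : ℝ) ≤ q := by exact_mod_cast hq
  have hB : 0 ≤ B := (sq_nonneg _).trans hf
  have e' : (h : ℝ) * ((q : ℝ) ^ n - 1) = (q : ℝ) ^ k * g - f := by exact_mod_cast e
  have hk1 : 1 ≤ (q : ℝ) ^ k := one_le_pow₀ (by linarith)
  have hpow : (q : ℝ) * (q : ℝ) ^ k ≤ (q : ℝ) ^ n := by
    rw [← pow_succ']
    exact pow_le_pow_right₀ (by linarith) hkn
  have h2k : 2 * (q : ℝ) ^ k ≤ q * (q : ℝ) ^ k := by gcongr
  have hn0 : 0 < (q : ℝ) ^ n - 1 := by linarith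
  have h2n : 2 * ((q : ℝ) ^ n - 1) ≤ q * ((q : ℝ) ^ n - 1) := by gcongr
  have hkq : (q : ℝ) ^ k + 1 ≤ q * ((q : ℝ) ^ n - 1) := by linarith
  have hfa := Real.abs_le_sqrt hf
  have hga := Real.abs_le_sqrt hg
  have h1 : |(h : ℝ)| * ((q : ℝ) ^ n - 1) ≤ (q * √B) * ((q : ℝ) ^ n - 1) := by
    calc |(h : ℝ)| * ((q : ℝ) ^ n - 1) = |(q : ℝ) ^ k * g - f| := by
          rw [← e', abs_mul, abs_of_pos hn0]
      _ ≤ |(q : ℝ) ^ k * g| + |(f : ℝ)| := abs_sub _ _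
      _ = (q : ℝ) ^ k * |(g : ℝ)| + |(f : ℝ)| := by rw [abs_mul, abs_of_pos (by linarith)]
      _ ≤ (q : ℝ) ^ k * √B + √B := by gcongr
      _ = ((q : ℝ) ^ k + 1) * √B := by ring
      _ ≤ (q * ((q : ℝ) ^ n - 1)) * √B := by gcongr
      _ = _ := by ring
  have h3 := le_of_mul_le_mul_right h1 hn0
  calc (h : ℝ) ^ 2 = |(h : ℝ)| ^ 2 := (sq_abs _).symm
    _ ≤ (q * √B) ^ 2 := by gcongr
    _ = _ := by rw [mul_pow, Real.sq_sqrt hB]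

/-- The size of a conjugator whose exponent `k` is a residue mod `n`. -/
lemma size_le_of_conj {q : ℕ} {hq : 2 ≤ q} {n k : ℕ} (hkn : k < n) {f g h : ℚ} {L L' : ℝ}
    (hf : MatrixBound q n f L) (hg : MatrixBound q n g L') {γ : BS q} (hγ : ActsAs hq γ k h)
    (e : h * ((q : ℚ) ^ n - 1) = (q : ℚ) ^ k * g - f) : size hq γ ≤ 4 * (L + L') := by
  have h2 : (2 : ℝ) ≤ q := by exact_mod_cast hq
  have h0 : (0 : ℝ) < q := by linarith
  have hlog : 0 < Real.log q := Real.log_pos (by linarith)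
  obtain ⟨hh, hsize⟩ := hγ.size_eq
  have hn1 : (1 : ℝ) ≤ n := by exact_mod_cast (by omega : 1 ≤ n)
  have hnL : (n : ℝ) ≤ L := by simpa using (le_abs_self _).trans hf.abs_le
  have hnL' : (n : ℝ) ≤ L' := by simpa using (le_abs_self _).trans hg.abs_le
  set T := L + L' with hT
  obtain ⟨M, hM0, -, hfM, hML⟩ := hf.exists_mem
  obtain ⟨N, hN0, -, hgN, hNL⟩ := hg.exists_mem
  have hhM : h ∈ qBall q 0 (M + N) := by
    refine mem_qBall_of_mul_mem hq (by omega : 0 < n) hh ?_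
    obtain ⟨i, hi⟩ := qBall_subset hq 0 (by omega : M + N ≤ M) hfM
    obtain ⟨j, hj⟩ := qBall_subset hq 0 (by omega : M + N ≤ N) hgN
    refine ⟨(q : ℤ) ^ k * j - i, ?_⟩
    rw [e, hi, hj]
    push_cast
    ring
  have hB : ∀ {x : ℚ} {K : ℝ}, MatrixBound q n x K → n + K ≤ T →
      (x : ℝ) ^ 2 ≤ Real.exp (Real.log q * T) := by
    intro x K hx hK
    refine hx.sq_le.trans ?_
    rw [zpow_eq_exp hq, ← Real.exp_add, ← mul_add]
    gcongr
    exact_mod_cast hK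
  have hh2 := sq_le_of_conj hq hkn e (hB hf (by linarith)) (hB hg (by linarith))
  have hkT : (q : ℝ) ^ (k : ℤ) ≤ Real.exp (Real.log q * T) := by
    rw [zpow_eq_exp hq]
    gcongr
    have : (k : ℝ) ≤ n := by exact_mod_cast hkn.le
    push_cast
    linarith
  have h1T : 1 ≤ Real.exp (Real.log q * T) :=
    Real.one_le_exp (mul_nonneg hlog.le (by linarith))
  have hd : hypDist q UpperHalfPlane.I (actH hq k h UpperHalfPlane.I) ≤ T + 3 := by
    rw [hypDist, div_le_iff₀' hlog, ← Real.exp_le_exp]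
    refine (exp_dist_le hq (by positivity) h).trans ?_
    have hq3 : Real.exp (Real.log q * (T + 3)) = (q : ℝ) ^ 3 * Real.exp (Real.log q * T) := by
      rw [mul_add, Real.exp_add, mul_comm, ← Real.exp_log (pow_pos h0 3), Real.log_pow]
      push_cast
      ring_nf
    have hq2 : (q : ℝ) ^ 2 + 2 ≤ (q : ℝ) ^ 3 := by nlinarith
    rw [hq3]
    nlinarith [mul_le_mul_of_nonneg_right hq2 (zero_le_one.trans h1T)]
  have hup := spaceDist_act_le hq k hh (by omega : M + N ≤ 0) hhM
  rw [hsize]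
  push_cast at hup hML hNL
  linarith

/-- A conjugator between elements of positive exponent can be shortened by a power of the second
element, which makes its own exponent a residue. -/
lemma exists_short_conjugator_of_pos {q : ℕ} {hq : 2 ≤ q} {u v γ : BS q} {n : ℕ} (hn : 0 < n)
    {f g : ℚ} {L L' : ℝ} (hu : ActsAs hq u n f) (hv : ActsAs hq v n g)
    (hf : MatrixBound q n f L) (hg : MatrixBound q n g L') (hγ : u * γ = γ * v) :
    ∃ δ, u * δ = δ * v ∧ size hq δ ≤ 4 * (L + L') := by
  obtain ⟨k, h, hk⟩ := exists_actsAs hq γ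
  obtain ⟨x, hx⟩ := hv.exists_zpow (-(k / n))
  have hδ : u * (γ * v ^ (-(k / n : ℤ))) = γ * v ^ (-(k / n : ℤ)) * v := by
    rw [← mul_assoc, hγ, mul_assoc, mul_assoc, (Commute.refl v).zpow_right _]
  refine ⟨_, hδ, ?_⟩
  have hm := hk.mul hx
  set y := h + (q : ℚ) ^ k * x
  have hn' : (0 : ℤ) < n := by exact_mod_cast hn
  obtain ⟨r, hr⟩ := Int.eq_ofNat_of_zero_le (Int.emod_nonneg k hn'.ne')
  have hrk : k + -(k / n : ℤ) * n = r := by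
    have := Int.emod_add_mul_ediv k n
    rw [← hr]
    linarith
  rw [hrk] at hm
  have hrn : r < n := by
    have := Int.emod_lt_of_pos k hn'
    omega
  refine size_le_of_conj hrn hf hg hm ?_
  have h1 := hu.mul hm
  rw [hδ] at h1
  have h2 := (h1.unique (hm.mul hv)).2
  rw [zpow_natCast, zpow_natCast] at h2
  linear_combination h2

lemma exists_short_conjugator {q : ℕ} (hq : 2 ≤ q) {u v γ : BS q} (hγ : u * γ = γ * v) :
    ∃ δ, u * δ = δ * v ∧ size hq δ ≤ 4 * (size hq u + size hq v) := by
  have h0 : (q : ℚ) ≠ 0 := by exact_mod_cast (by omega : q ≠ 0)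
  obtain ⟨n, f, hu⟩ := exists_actsAs hq u
  obtain ⟨n', g, hv⟩ := exists_actsAs hq v
  obtain ⟨k, h, hk⟩ := exists_actsAs hq γ
  have hf := hu.matrixBound
  have hg := hv.matrixBound
  have h1 := hu.mul hk
  rw [hγ] at h1
  obtain ⟨e1, e2⟩ := h1.unique (hk.mul hv)
  obtain rfl : n = n' := by omega
  have hu0 := (abs_nonneg _).trans hf.abs_le
  have hv0 := (abs_nonneg _).trans hg.abs_le
  rcases lt_trichotomy n 0 with hn | rfl | hn
  · -- the inverses have the same conjugators, and matrices under the same bounds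
    obtain ⟨j, rfl⟩ := Int.exists_eq_neg_ofNat hn.le
    have hui := hu.inv
    have hvi := hv.inv
    have hfi := hf.inv hq
    have hgi := hg.inv hq
    simp only [neg_neg] at hui hvi hfi hgi
    have hγ' : u⁻¹ * γ = γ * v⁻¹ := by
      rw [inv_mul_eq_iff_eq_mul, ← mul_assoc, hγ, mul_inv_cancel_right]
    obtain ⟨δ, hδ, hs⟩ := exists_short_conjugator_of_pos (by omega) hui hvi hfi hgi hγ'
    refine ⟨δ, ?_, hs⟩
    rw [inv_mul_eq_iff_eq_mul, ← mul_assoc] at hδ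
    nth_rewrite 2 [hδ]
    rw [inv_mul_cancel_right]
  · -- here `f = q ^ k g`, so the translation part of the conjugator can be dropped
    have e : f = (q : ℚ) ^ k * g := by
      rw [zpow_zero] at e2
      linear_combination e2
    by_cases hg0 : g = 0
    · obtain rfl : u = v := by
        rw [hg0, mul_zero] at e
        subst hg0 e
        exact hu.ext hv
      refine ⟨1, by simp, ?_⟩
      obtain ⟨hz, hs⟩ := (ActsAs.one hq).size_eq
      have := spaceDist_act_le hq 0 hz le_rfl ⟨0, by simp⟩
      rw [hypDist_actH_zero, ← hs] at this
      simp at this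
      linarith
    · have ha := actsAs_genA_zpow hq k
      refine ⟨genA q ^ k, (hu.mul ha).ext (f := f + (q : ℚ) ^ (0 : ℤ) * 0) ?_, ?_⟩
      · convert ha.mul hv using 1
        rw [e]
        ring
      · -- moving `f` to `g` and `g` to `f` bounds `k` and `-k`, so `|k|` is at most half the total
        obtain ⟨hz, hs⟩ := ha.size_eq
        have hle := spaceDist_act_le hq k hz le_rfl ⟨0, by simp⟩
        rw [hypDist_actH_zero, ← hs] at hle
        have hk1 := two_mul_le_of_eq_zpow_mul hq hg0 e hf hg
        have e' : g = (q : ℚ) ^ (-k) * f := by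
          rw [e, ← mul_assoc, ← zpow_add₀ h0, neg_add_cancel, zpow_zero, one_mul]
        have hf0 : f ≠ 0 := by
          rintro rfl
          exact hg0 (by simpa using e')
        have hk2 := two_mul_le_of_eq_zpow_mul hq hf0 e' hg hf
        push_cast at hk2 hle
        have hk3 : |(k : ℝ)| ≤ (size hq u + size hq v) / 2 := abs_le.mpr ⟨by linarith, by linarith⟩
        linarith
  · obtain ⟨j, rfl⟩ := Int.eq_ofNat_of_zero_le hn.le
    exact exists_short_conjugator_of_pos (by omega) hu hv hf hg hγ

lemma size_nonneg {q : ℕ} (hq : 2 ≤ q) (γ : BS q) : 0 ≤ size hq γ := by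
  obtain ⟨n, f, h⟩ := exists_actsAs hq γ
  exact (abs_nonneg _).trans h.matrixBound.abs_le

end Treebolic

/-- For `q ≥ 2`, two elements `u, v` of the Baumslag-Solitar group `BS(1, q)` are conjugate if and
only if there is a conjugator `γ` with `|γ| ≤ (2 / log √2) (|u| + |v|)`. -/
theorem mainTheorem3 (q : ℕ) (hq : 2 ≤ q) (u v : Treebolic.BS q) :
    IsConj u v ↔ ∃ γ : Treebolic.BS q, u * γ = γ * v ∧
      Treebolic.size hq γ ≤
        2 / Real.log (Real.sqrt 2) * (Treebolic.size hq u + Treebolic.size hq v) := by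
  constructor
  · intro h
    obtain ⟨c, hc⟩ := isConj_iff.mp h
    have hγ : u * c⁻¹ = c⁻¹ * v := by rw [← hc]; group
    obtain ⟨δ, hδ, hs⟩ := Treebolic.exists_short_conjugator hq hγ
    refine ⟨δ, hδ, hs.trans ?_⟩
    have hu := Treebolic.size_nonneg hq u
    have hv := Treebolic.size_nonneg hq v
    -- `log √2 = (log 2) / 2 < 1 / 2`
    have h4 : 4 ≤ 2 / Real.log (Real.sqrt 2) := by
      have h2 := Real.log_two_lt_d9
      have h2' : 0 < Real.log 2 := Real.log_pos one_lt_two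
      rw [Real.log_sqrt (by norm_num), le_div_iff₀ (by linarith)]
      linarith
    exact mul_le_mul_of_nonneg_right h4 (by linarith)
  · rintro ⟨γ, hγ, -⟩
    exact isConj_iff.mpr ⟨γ⁻¹, by rw [inv_inv, mul_assoc, hγ, inv_mul_cancel_left]⟩
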